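/- For a partition $\mu=(\mu_1\ge\mu_2\ge\cdots\ge\mu_\ell>0)$ put $\mu_k=0$ for $k>\ell$ and $|\mu|=\sum_k\mu_k$. Let $r\ge 1$ and let $\boldsymbol c=(c_0,\dots,c_{r-1})$ be a family of nonnegative integers, where $c_i$ is indexed by the class of $i$ in $\mathbb Z/r\mathbb Z$. A cylindric partition of profile $\boldsymbol c$ is a family $\boldsymbol\lambda=(\lambda^{(i)})_{i\in\mathbb Z/r\mathbb Z}$ of partitions such that $\lambda^{(i)}_j\ge\lambda^{(i+1)}_{j+c_{i+1}}$ for all $i\in\mathbb Z/r\mathbb Z$ and all $j\ge 1$. Let $|\boldsymbol\lambda|=\sum_i|\lambda^{(i)}|$, and let $\max(\boldsymbol\lambda)$ be the largest part occurring in the $\lambda^{(i)}$ ($0$ if all of them are empty). Write $(a;t)_n=\prod_{0\le j<n}(1-at^j)$ for $n\in\mathbb Z_{\ge0}\sqcup\{\infty\}$, and define the formal power series $$F_{\boldsymbol c}(x,q)=\sum_{\boldsymbol\lambda}x^{\max(\boldsymbol\lambda)}q^{|\boldsymbol\lambda|},\qquad G_{\boldsymbol c}(x,q)=(xq;q)_\infty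 F_{\boldsymbol c}(x,q)$$ in $\mathbb Z[[x,q]]$, where the sum is over all cylindric partitions $\boldsymbol\lambda$ of profile $\boldsymbol c$. Then, for the profile $(3,0,0)$ (so $r=3$), in $\mathbb Z[[x,q]]$, $$G_{(3,0,0)}(x,q)=\sum_{a,b,c,d\ge 0}\frac{q^{a(a+1)+b(b+2)+3c(c+1)+3d(d+1)+2ab+3ac+3ad+3bc+3bd+6cd}}{(q;q)_a(q;q)_b(q^3;q^3)_c(q^3;q^3)_d}\,x^{a+b+c+2d}.$$ -/

import Mathlib

open scoped PowerSeries.WithPiTopology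

namespace CylindricAG

/-! ### Formal power series in two variables -/

/-- The ring `ℤ⟦q⟧⟦x⟧` of formal power series in `x` and `q`. With the topology opened above
(`ℤ` discrete, coefficientwise convergence in `q` and in `x`), `HasSum`, `∑'` and `∏'` are the usual
formal infinite sums and products. -/
abbrev Ser : Type := PowerSeries (PowerSeries ℤ)

/-- The variable `q`. -/
noncomputable def q : Ser := PowerSeries.C (PowerSeries.X : PowerSeries ℤ)

/-- The variable `x`. -/
noncomputable def x : Ser := PowerSeries.X

/-- `(a;t)_n = ∏_{0 ≤ j < n} (1 - a t^j)`. -/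
noncomputable def poch (a t : Ser) (n : ℕ) : Ser := ∏ j ∈ Finset.range n, (1 - a * t ^ j)

/-- `(a;t)_∞ = ∏_{j ≥ 0} (1 - a t^j)`. -/
noncomputable def pochInf (a t : Ser) : Ser := ∏' j : ℕ, (1 - a * t ^ j)

/-! ### Cylindric partitions -/

/-- Partitions, as weakly decreasing sequences of nonnegative integers with finitely many nonzero
terms: `part j` is the `(j+1)`-st part `λ_{j+1}`, which is `0` beyond the length of `λ`. -/
@[ext]
structure IntPartition where
  part : ℕ →₀ ℕ
  anti : Antitone part

/-- The size `|λ|`, the sum of all parts. -/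
def IntPartition.size (p : IntPartition) : ℕ := ∑ j ∈ p.part.support, p.part j

/-- The largest part (`0` for the empty partition). -/
def IntPartition.max (p : IntPartition) : ℕ := p.part.support.sup p.part

/-- The profile `(c_0, …, c_{r-1})` in one-line format: `c_i` is the entry at `i + rℤ`. -/
def profile {r : ℕ} [NeZero r] (c : Fin r → ℕ) : ZMod r → ℕ := fun i => c ⟨i.val, i.val_lt⟩

/-- Cylindric partitions of profile `c`: families of partitions indexed by `ℤ/rℤ` with
`λ^{(i)}_j ≥ λ^{(i+1)}_{j + c_{i+1}}` for all `i ∈ ℤ/rℤ` and `j ≥ 1`. -/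
@[ext]
structure CylPartition {r : ℕ} (c : ZMod r → ℕ) where
  comp : ZMod r → IntPartition
  cyl : ∀ (i : ZMod r) (j : ℕ), (comp (i + 1)).part (j + c (i + 1)) ≤ (comp i).part j

section

variable {r : ℕ} [NeZero r] {c : ZMod r → ℕ}

/-- The size of a cylindric partition: the sum of the sizes of its components. -/
def CylPartition.size (l : CylPartition c) : ℕ := ∑ i : ZMod r, (l.comp i).size

/-- The largest part among all components (`0` if all components are empty). -/
def CylPartition.max (l : CylPartition c) : ℕ := Finset.univ.sup fun i : ZMod r => (l.comp i).max

end

/-- `F_c(x,q) = ∑_λ x^{max λ} q^{|λ|}`, over all cylindric partitions `λ` of profile `c`. -/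
noncomputable def F {r : ℕ} [NeZero r] (c : ZMod r → ℕ) : Ser :=
  ∑' l : CylPartition c, x ^ l.max * q ^ l.size

/-- `G_c(x,q) = (xq;q)_∞ F_c(x,q)`. -/
noncomputable def G {r : ℕ} [NeZero r] (c : ZMod r → ℕ) : Ser := pochInf (x * q) q * F c

/-! ### The sums, products and inverses above are genuine -/

theorem coeff_x_pow_mul_q_pow (a b m n : ℕ) :
    PowerSeries.coeff n (PowerSeries.coeff m (x ^ a * q ^ b : Ser)) =
      if m = a ∧ n = b then 1 else 0 := by
  have h : (x ^ a * q ^ b : Ser) = PowerSeries.monomial a (PowerSeries.X ^ b : PowerSeries ℤ) := by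
    rw [x, q, ← map_pow, mul_comm, PowerSeries.monomial_eq_mk]
    ext1 k
    rw [PowerSeries.coeff_C_mul, PowerSeries.coeff_X_pow, PowerSeries.coeff_mk]
    split_ifs <;> simp
  rw [h, PowerSeries.coeff_monomial]
  split_ifs with h1 h2 h2 <;> simp_all [PowerSeries.coeff_X_pow]

theorem summable_of_finite {ι : Type*} (f : ι → Ser)
    (h : ∀ m n, {i | PowerSeries.coeff n (PowerSeries.coeff m (f i)) ≠ 0}.Finite) :
    Summable f := by
  rw [PowerSeries.WithPiTopology.summable_iff_summable_coeff]
  intro m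
  rw [PowerSeries.WithPiTopology.summable_iff_summable_coeff]
  intro n
  exact summable_of_hasFiniteSupport (h m n)

theorem IntPartition.part_eq_zero (p : IntPartition) {j : ℕ} (h : p.size ≤ j) : p.part j = 0 := by
  by_contra hj
  have hsub : Finset.range (j + 1) ⊆ p.part.support := by
    intro k hk
    have := p.anti (Nat.lt_succ_iff.1 (Finset.mem_range.1 hk))
    rw [Finsupp.mem_support_iff]
    omega
  have h1 : (Finset.range (j + 1)).card ≤ p.part.support.card := Finset.card_le_card hsub
  have h2 : p.part.support.card ≤ p.size := by
    rw [IntPartition.size, Finset.card_eq_sum_ones]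
    refine Finset.sum_le_sum fun k hk => ?_
    have := Finsupp.mem_support_iff.1 hk
    omega
  simp at h1
  omega

theorem IntPartition.part_le_size (p : IntPartition) (j : ℕ) : p.part j ≤ p.size := by
  by_cases hj : j ∈ p.part.support
  · exact Finset.single_le_sum (f := fun j => p.part j) (fun _ _ => Nat.zero_le _) hj
  · rw [Finsupp.notMem_support_iff.1 hj]
    exact Nat.zero_le _

theorem finite_size_eq {r : ℕ} [NeZero r] (c : ZMod r → ℕ) (n : ℕ) :
    {l : CylPartition c | l.size = n}.Finite := by
  have hle : ∀ l : CylPartition c, ∀ i, (l.comp i).size ≤ l.size := fun l i =>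
    Finset.single_le_sum (f := fun i => (l.comp i).size) (fun _ _ => Nat.zero_le _)
      (Finset.mem_univ i)
  rw [← Set.finite_coe_iff]
  let g : {l : CylPartition c | l.size = n} → ZMod r → Fin n → Fin (n + 1) := fun l i j =>
    ⟨(l.1.comp i).part j, Nat.lt_succ_of_le
      (((l.1.comp i).part_le_size j).trans ((hle l.1 i).trans l.2.le))⟩
  refine Finite.of_injective g ?_
  rintro ⟨l, hl⟩ ⟨l', hl'⟩ h
  simp only [Set.mem_ofPred_eq] at hl hl'
  apply Subtype.ext
  ext i j
  by_cases hj : j < n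
  · have := congrArg Fin.val (congrFun (congrFun h i) ⟨j, hj⟩)
    exact this
  · have e1 := hle l i
    have e2 := hle l' i
    exact ((l.comp i).part_eq_zero (by omega)).trans
      ((l'.comp i).part_eq_zero (by omega)).symm

/-- The series defining `F c` converges. -/
theorem summable_F {r : ℕ} [NeZero r] (c : ZMod r → ℕ) :
    Summable fun l : CylPartition c => x ^ l.max * q ^ l.size := by
  refine summable_of_finite _ fun m n => (finite_size_eq c n).subset fun l hl => ?_
  rw [Set.mem_ofPred_eq, coeff_x_pow_mul_q_pow] at hl
  by_contra h
  exact hl (if_neg fun h' => h h'.2.symm)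

/-- The product `(xq;q)_∞` converges. -/
theorem multipliable_pochInf : Multipliable fun j : ℕ => (1 - (x * q) * q ^ j : Ser) := by
  have hs : Summable fun s : Finset ℕ => ∏ j ∈ s, (-(x * q * q ^ j) : Ser) := by
    refine summable_of_finite _ fun m n =>
      ((Finset.range (n + 1)).powerset.finite_toSet).subset fun s hs => ?_
    have e : ∏ j ∈ s, (-(x * q * q ^ j) : Ser) =
        (-1) ^ s.card * (x ^ s.card * q ^ (∑ j ∈ s, (j + 1))) := by
      rw [← Finset.prod_pow_eq_pow_sum, ← Finset.prod_const, ← Finset.prod_const,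
        ← Finset.prod_mul_distrib, ← Finset.prod_mul_distrib]
      refine Finset.prod_congr rfl fun j _ => ?_
      ring
    rw [Set.mem_ofPred_eq, e] at hs
    have hn : n = ∑ j ∈ s, (j + 1) := by
      by_contra h
      apply hs
      rcases neg_one_pow_eq_or Ser s.card with h1 | h1 <;> rw [h1] <;>
        simp [coeff_x_pow_mul_q_pow, h]
    rw [Finset.mem_coe, Finset.mem_powerset]
    intro j hj
    have := Finset.single_le_sum (f := fun j => j + 1) (fun _ _ => Nat.zero_le _) hj
    rw [Finset.mem_range]
    omega
  have := multipliable_one_add_of_summable_prod hs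
  simpa only [← sub_eq_add_neg] using this

/-- `(q^k;q^k)_n` is invertible for `k ≥ 1`. -/
theorem isUnit_poch {k : ℕ} (hk : k ≠ 0) (n : ℕ) : IsUnit (poch (q ^ k) (q ^ k) n) := by
  rw [PowerSeries.isUnit_iff_constantCoeff, PowerSeries.isUnit_iff_constantCoeff]
  simp [poch, q, map_prod, hk]

end CylindricAG

namespace CylindricAG

/-! Both sides solve one linear `q³`-difference equation, `CubicDilEq`, relating a series to its
images under `x ↦ x q³` and `x ↦ x q⁶`. A solution is determined by its constant term in `x`
(`CubicDilEq.eq`), which is 1 on both sides.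

Sum side: multiplying the general term by `1 - q^a`, `1 - q^b`, `1 - q^(3c)` or `1 - q^(3d)` and
reindexing gives contiguous relations between sums with different linear exponents. The difference
equation is an explicit combination of them (`cubicDilEq_pairSum`).

Partition side: inclusion-exclusion over the sets of components attaining the largest part, followed
by deletion of those parts, gives the Corteel–Welsh equations (`G_eq_sum`). In rank 3 and level 3
there are four profiles up to rotation, so the system closes. Eliminating the other three leaves the
equation for (3,0,0) (`cubicDilEq_G`). -/

/-! ### The substitution `x ↦ x q ^ k` -/

/-- The substitution `x ↦ x q ^ k`. -/
noncomputable def dil (k : ℕ) : Ser →+* Ser :=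
  PowerSeries.rescale ((PowerSeries.X : PowerSeries ℤ) ^ k)

theorem coeff_dil (k n : ℕ) (f : Ser) :
    PowerSeries.coeff n (dil k f) = PowerSeries.X ^ (k * n) * PowerSeries.coeff n f := by
  rw [dil, PowerSeries.coeff_rescale, pow_mul]

@[simp]
theorem dil_x (k : ℕ) : dil k x = x * q ^ k := by
  rw [dil, x, PowerSeries.rescale_X, q, map_pow, mul_comm]

@[simp]
theorem dil_q (k : ℕ) : dil k q = q := by
  ext n : 1
  rw [coeff_dil, q, PowerSeries.coeff_C]
  split_ifs with h <;> simp [h]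

theorem dil_dil (k l : ℕ) (f : Ser) : dil k (dil l f) = dil (k + l) f := by
  ext n : 1
  simp only [coeff_dil]
  ring

theorem continuous_dil (k : ℕ) : Continuous (dil k) := by
  rw [continuous_iff_continuousAt]
  intro f
  rw [ContinuousAt, PowerSeries.WithPiTopology.tendsto_iff_coeff_tendsto]
  intro n
  simp only [coeff_dil]
  exact (continuous_const.mul (PowerSeries.WithPiTopology.continuous_coeff _ n)).continuousAt

theorem dil_inverse {k : ℕ} {f : Ser} (hf : IsUnit f) (h : dil k f = f) :
    dil k (Ring.inverse f) = Ring.inverse f := by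
  obtain ⟨u, rfl⟩ := hf
  rw [Ring.inverse_unit]
  have h1 : dil k (u⁻¹ : Serˣ) * (u : Ser) = 1 := by
    calc dil k (u⁻¹ : Serˣ) * (u : Ser) = dil k (u⁻¹ : Serˣ) * dil k (u : Ser) := by rw [h]
      _ = 1 := by rw [← map_mul, Units.inv_mul, map_one]
  exact (Units.inv_eq_of_mul_eq_one_left h1).symm

/-! ### Inverse `q`-factorials -/

/-- `1 / (q^k;q^k)_n`. -/
noncomputable def invPoch (k n : ℕ) : Ser := Ring.inverse (poch (q ^ k) (q ^ k) n)

theorem invPoch_succ {k : ℕ} (hk : k ≠ 0) (n : ℕ) :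
    (1 - q ^ (k * (n + 1))) * invPoch k (n + 1) = invPoch k n := by
  have h : poch (q ^ k) (q ^ k) (n + 1) = poch (q ^ k) (q ^ k) n * (1 - q ^ (k * (n + 1))) := by
    rw [poch, Finset.prod_range_succ, ← poch]
    congr 2
    ring
  have h1 := Ring.mul_inverse_cancel _ (isUnit_poch hk (n + 1))
  have h2 := Ring.inverse_mul_cancel _ (isUnit_poch hk n)
  rw [h] at h1
  rw [invPoch, invPoch, h]
  linear_combination Ring.inverse (poch (q ^ k) (q ^ k) n) * h1 -
    (1 - q ^ (k * (n + 1))) *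
      Ring.inverse (poch (q ^ k) (q ^ k) n * (1 - q ^ (k * (n + 1)))) * h2

theorem dil_invPoch {k : ℕ} (hk : k ≠ 0) (l n : ℕ) : dil l (invPoch k n) = invPoch k n :=
  dil_inverse (isUnit_poch hk n) (by simp [poch])

/-! ### The quadruple sums -/

/-- The general term of the quadruple sums, with linear exponents `u` in `q`. -/
noncomputable def quadTerm (u₁ u₂ u₃ u₄ : ℕ) (p : ℕ × ℕ × ℕ × ℕ) : Ser :=
  q ^ ((p.1 + p.2.1) ^ 2 + 3 * (p.2.2.1 + p.2.2.2) ^ 2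
      + 3 * (p.1 + p.2.1) * (p.2.2.1 + p.2.2.2)
      + (u₁ * p.1 + u₂ * p.2.1 + u₃ * p.2.2.1 + u₄ * p.2.2.2))
    * (invPoch 1 p.1 * invPoch 1 p.2.1 * invPoch 3 p.2.2.1 * invPoch 3 p.2.2.2)
    * x ^ (p.1 + p.2.1 + p.2.2.1 + 2 * p.2.2.2)

/-- The quadruple sum with linear exponents `u` in `q`. -/
noncomputable def quadSum (u₁ u₂ u₃ u₄ : ℕ) : Ser := ∑' p, quadTerm u₁ u₂ u₃ u₄ p

theorem summable_mul_x_pow {ι : Type*} (f : ι → Ser) (e : ι → ℕ)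
    (h : ∀ m, {i | e i ≤ m}.Finite) : Summable fun i => f i * x ^ e i := by
  refine summable_of_finite _ fun m n => (h m).subset fun i hi => ?_
  by_contra hlt
  apply hi
  rw [x, PowerSeries.coeff_mul_X_pow', if_neg (by simpa using hlt), map_zero]

theorem finite_weight_le (m : ℕ) :
    {p : ℕ × ℕ × ℕ × ℕ | p.1 + p.2.1 + p.2.2.1 + 2 * p.2.2.2 ≤ m}.Finite := by
  refine (Set.finite_Iic ((m, m, m, m) : ℕ × ℕ × ℕ × ℕ)).subset ?_
  rintro ⟨a, b, c, d⟩ h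
  simp only [Set.mem_ofPred_eq] at h
  simp only [Set.mem_Iic, Prod.mk_le_mk]
  omega

theorem summable_quadTerm (u₁ u₂ u₃ u₄ : ℕ) : Summable (quadTerm u₁ u₂ u₃ u₄) :=
  summable_mul_x_pow _ _ finite_weight_le

theorem dil_quadSum (k u₁ u₂ u₃ u₄ : ℕ) :
    dil k (quadSum u₁ u₂ u₃ u₄) = quadSum (u₁ + k) (u₂ + k) (u₃ + k) (u₄ + 2 * k) := by
  rw [quadSum, (summable_quadTerm _ _ _ _).map_tsum _ (continuous_dil k)]
  refine tsum_congr fun p => ?_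
  simp only [quadTerm, map_mul, map_pow, dil_x, dil_q, dil_invPoch one_ne_zero,
    dil_invPoch three_ne_zero]
  ring

/-! ### Contiguous relations for the quadruple sums -/

/-- Two quadruple sums whose difference is supported on the image of an index shift. -/
theorem quadSum_sub {u₁ u₂ u₃ u₄ v₁ v₂ v₃ v₄ w₁ w₂ w₃ w₄ : ℕ} (r : Ser)
    (s : ℕ × ℕ × ℕ × ℕ → ℕ × ℕ × ℕ × ℕ) (hs : s.Injective)
    (h : ∀ p, quadTerm u₁ u₂ u₃ u₄ (s p) - quadTerm v₁ v₂ v₃ v₄ (s p) =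
      r * quadTerm w₁ w₂ w₃ w₄ p)
    (h0 : ∀ p, p ∉ Set.range s → quadTerm u₁ u₂ u₃ u₄ p = quadTerm v₁ v₂ v₃ v₄ p) :
    quadSum u₁ u₂ u₃ u₄ - quadSum v₁ v₂ v₃ v₄ = r * quadSum w₁ w₂ w₃ w₄ := by
  rw [quadSum, quadSum, quadSum,
    ← (summable_quadTerm _ _ _ _).tsum_sub (summable_quadTerm _ _ _ _),
    ← (summable_quadTerm _ _ _ _).tsum_mul_left, ← hs.tsum_eq]
  · exact tsum_congr h
  · intro p hp
    by_contra hp'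
    exact hp (sub_eq_zero.2 (h0 p hp'))

/-- The factor `1 - q^a` kills the terms with `a = 0` and turns `1/(q;q)_a` into `1/(q;q)_{a-1}`.
Replacing `a` by `a + 1` then changes the quadratic exponent by `1 + 2a + 2b + 3c + 3d`, which
produces the shifts. -/
theorem quadSum_sub_first (u₁ u₂ u₃ u₄ : ℕ) :
    quadSum u₁ u₂ u₃ u₄ - quadSum (u₁ + 1) u₂ u₃ u₄ =
      x * q ^ (1 + u₁) * quadSum (u₁ + 2) (u₂ + 2) (u₃ + 3) (u₄ + 3) := by
  refine quadSum_sub _ (fun p => (p.1 + 1, p.2)) ?_ ?_ ?_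
  · rintro ⟨a, b, c, d⟩ ⟨a', b', c', d'⟩ h
    simpa using h
  · rintro ⟨a, b, c, d⟩
    simp only [quadTerm]
    rw [← invPoch_succ one_ne_zero a]
    ring
  · rintro ⟨_ | a, p⟩ hp
    · simp [quadTerm]
    · exact absurd ⟨(a, p), rfl⟩ hp

theorem quadSum_sub_second (u₁ u₂ u₃ u₄ : ℕ) :
    quadSum u₁ u₂ u₃ u₄ - quadSum u₁ (u₂ + 1) u₃ u₄ =
      x * q ^ (1 + u₂) * quadSum (u₁ + 2) (u₂ + 2) (u₃ + 3) (u₄ + 3) := by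
  refine quadSum_sub _ (fun p => (p.1, p.2.1 + 1, p.2.2)) ?_ ?_ ?_
  · rintro ⟨a, b, c, d⟩ ⟨a', b', c', d'⟩ h
    simpa using h
  · rintro ⟨a, b, c, d⟩
    simp only [quadTerm]
    rw [← invPoch_succ one_ne_zero b]
    ring
  · rintro ⟨a, _ | b, p⟩ hp
    · simp [quadTerm]
    · exact absurd ⟨(a, b, p), rfl⟩ hp

theorem quadSum_sub_third (u₁ u₂ u₃ u₄ : ℕ) :
    quadSum u₁ u₂ u₃ u₄ - quadSum u₁ u₂ (u₃ + 3) u₄ =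
      x * q ^ (3 + u₃) * quadSum (u₁ + 3) (u₂ + 3) (u₃ + 6) (u₄ + 6) := by
  refine quadSum_sub _ (fun p => (p.1, p.2.1, p.2.2.1 + 1, p.2.2.2)) ?_ ?_ ?_
  · rintro ⟨a, b, c, d⟩ ⟨a', b', c', d'⟩ h
    simpa using h
  · rintro ⟨a, b, c, d⟩
    simp only [quadTerm]
    rw [← invPoch_succ three_ne_zero c]
    ring
  · rintro ⟨a, b, _ | c, d⟩ hp
    · simp [quadTerm]
    · exact absurd ⟨(a, b, c, d), rfl⟩ hp

theorem quadSum_sub_fourth (u₁ u₂ u₃ u₄ : ℕ) :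
    quadSum u₁ u₂ u₃ u₄ - quadSum u₁ u₂ u₃ (u₄ + 3) =
      x ^ 2 * q ^ (3 + u₄) * quadSum (u₁ + 3) (u₂ + 3) (u₃ + 6) (u₄ + 6) := by
  refine quadSum_sub _ (fun p => (p.1, p.2.1, p.2.2.1, p.2.2.2 + 1)) ?_ ?_ ?_
  · rintro ⟨a, b, c, d⟩ ⟨a', b', c', d'⟩ h
    simpa using h
  · rintro ⟨a, b, c, d⟩
    simp only [quadTerm]
    rw [← invPoch_succ three_ne_zero d]
    ring
  · rintro ⟨a, b, c, _ | d⟩ hp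
    · simp [quadTerm]
    · exact absurd ⟨(a, b, c, d), rfl⟩ hp

/-- The quadruple sums in which the exponent of `q` depends on `a + b`, `b` and `c + d` only. -/
noncomputable def pairSum (k l : ℕ) : Ser := quadSum k (k + 1) (3 * l) (3 * l)

/-- Raising the exponents of `a` and `b` one after the other produces a sum outside the `pairSum`
family. A second relation in `a` (`h3`) brings it back, at the cost of the quadratic term in `x`.
The relation for `c` and `d` below works the same way. -/
theorem pairSum_sub_left (k l : ℕ) :
    pairSum k l - pairSum (k + 1) l =
      (1 + q) * x * q ^ (1 + k) * pairSum (k + 2) (l + 1)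
        - x ^ 2 * q ^ (5 + 2 * k) * pairSum (k + 4) (l + 2) := by
  have h1 := quadSum_sub_first k (k + 1) (3 * l) (3 * l)
  have h2 := quadSum_sub_second (k + 1) (k + 1) (3 * l) (3 * l)
  have h3 := quadSum_sub_first (k + 2) (k + 3) (3 * l + 3) (3 * l + 3)
  simp only [pairSum, mul_add, mul_one, add_assoc, Nat.reduceAdd, Nat.reduceMul] at *
  linear_combination h1 + h2 - x * q ^ (k + 2) * h3

theorem pairSum_sub_right (k l : ℕ) :
    pairSum k l - pairSum k (l + 1) =
      (1 + x) * x * q ^ (3 + 3 * l) * pairSum (k + 3) (l + 2)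
        - x ^ 3 * q ^ (12 + 6 * l) * pairSum (k + 6) (l + 4) := by
  have h1 := quadSum_sub_third k (k + 1) (3 * l) (3 * l)
  have h2 := quadSum_sub_fourth k (k + 1) (3 * l + 3) (3 * l)
  have h3 := quadSum_sub_third (k + 3) (k + 4) (3 * l + 6) (3 * l + 6)
  simp only [pairSum, mul_add, mul_one, add_assoc, Nat.reduceAdd, Nat.reduceMul] at *
  linear_combination h1 + h2 - x ^ 2 * q ^ (3 * l + 3) * h3

/-- Since `d` has weight 2 in `x`, the dilation raises the exponent of `d` by 6 but that of `c` only
by 3. The excess 3 is exactly one step of the relation in `d`, so dilation by `q³` preserves the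
span of the family. -/
theorem dil_three_pairSum (k l : ℕ) :
    dil 3 (pairSum k l) =
      pairSum (k + 3) (l + 1) - x ^ 2 * q ^ (6 + 3 * l) * pairSum (k + 6) (l + 3) := by
  have h := quadSum_sub_fourth (k + 3) (k + 4) (3 * l + 3) (3 * l + 3)
  simp only [pairSum, dil_quadSum, mul_add, mul_one, add_assoc, Nat.reduceAdd, Nat.reduceMul] at *
  linear_combination -h

/-! ### The common difference equation and the uniqueness of its solution -/

/-- The second order `q³`-difference equation of `G_{(3,0,0)}`. -/
def CubicDilEq (f : Ser) : Prop :=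
  (1 + x * q ^ 5) * f =
    ((1 + x * q ^ 5) * (1 - x * q ^ 2) * (x * q ^ 3) + (1 + x * q ^ 2) *
        (1 + x * (q ^ 3 + 2 * q ^ 4 + 2 * q ^ 5) + x ^ 2 * (q ^ 8 + q ^ 9))) * dil 3 f
      + x * q ^ 6 * (1 + x * q ^ 2) * (1 - x * q ^ 4) * (1 - x * q ^ 5) * dil 6 f

theorem cubicDilEq_pairSum : CubicDilEq (pairSum 1 1) := by
  have h6 : dil 6 (pairSum 1 1) = dil 3 (dil 3 (pairSum 1 1)) := (dil_dil 3 3 _).symm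
  have hI := pairSum_sub_left
  have hJ := pairSum_sub_right
  rw [CubicDilEq, h6]
  simp only [dil_three_pairSum, map_sub, map_mul, map_pow, dil_x, dil_q, Nat.reduceAdd,
    Nat.reduceMul]
  -- Everything is now a combination of series `pairSum k l` over `ℤ[x,q]`; the coefficients below
  -- certify that the equation lies in the span of the contiguous relations.
  linear_combination
    (1 + x * q ^ 5) * hI 1 1 +
    (1 + x * q ^ 2 + x * q ^ 3 + x * q ^ 4 + x * q ^ 5 + x ^ 2 * q ^ 5 + x ^ 2 * q ^ 6 +
      x ^ 2 * q ^ 7) * hI 2 1 +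
    (-x * q ^ 2 - x * q ^ 3 - x * q ^ 4 - x ^ 2 * q ^ 5 - x ^ 2 * q ^ 6 - x ^ 2 * q ^ 7) * hI 2 2
      +
    (1 + x * q ^ 2 - x * q ^ 3 - x * q ^ 4 - x ^ 2 * q ^ 5 - x ^ 2 * q ^ 6 + x ^ 2 * q ^ 7 +
      x ^ 3 * q ^ 9) * hI 3 1 +
    (2 * x * q ^ 3 + x * q ^ 4 + x * q ^ 5 + x ^ 2 * q ^ 5 + x ^ 2 * q ^ 6 + x ^ 2 * q ^ 8 -
      x ^ 3 * q ^ 9) * hI 3 2 +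
    (-x * q ^ 4 - x * q ^ 5 - x ^ 2 * q ^ 6 + x ^ 2 * q ^ 8 + x ^ 3 * q ^ 9 + x ^ 3 * q ^ 10)
      * hI 4 2 +
    (-x ^ 2 * q ^ 6 - x ^ 2 * q ^ 7 - x ^ 2 * q ^ 8 - x ^ 3 * q ^ 9 - x ^ 3 * q ^ 10 -
      x ^ 3 * q ^ 11) * hI 4 3 +
    (-x ^ 2 * q ^ 6 - x ^ 3 * q ^ 8 - x ^ 3 * q ^ 9 - x ^ 3 * q ^ 10 - x ^ 3 * q ^ 11 -
      x ^ 4 * q ^ 11 - x ^ 4 * q ^ 12 - x ^ 4 * q ^ 13) * hI 5 3 +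
    (-x ^ 2 * q ^ 6 - x ^ 3 * q ^ 8 + x ^ 3 * q ^ 9 + x ^ 3 * q ^ 10 + x ^ 4 * q ^ 11 +
      x ^ 4 * q ^ 12 - x ^ 4 * q ^ 13 - x ^ 5 * q ^ 15) * hI 6 3 +
    (-x ^ 3 * q ^ 12 - x ^ 3 * q ^ 13 - x ^ 3 * q ^ 14 - x ^ 4 * q ^ 15 - x ^ 4 * q ^ 16 -
      x ^ 4 * q ^ 17) * hI 6 4 +
    (x ^ 3 * q ^ 13 + x ^ 3 * q ^ 14 + x ^ 4 * q ^ 15 - x ^ 4 * q ^ 17 - x ^ 5 * q ^ 18 -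
      x ^ 5 * q ^ 19) * hI 7 4 +
    (-x * q ^ 2 - x * q ^ 3 - x * q ^ 4 - x ^ 2 * q ^ 5 - x ^ 2 * q ^ 6 - x ^ 2 * q ^ 7) * hJ 2 1
      +
    (2 * x * q ^ 3 + 2 * x * q ^ 4 + x * q ^ 5 + 2 * x ^ 2 * q ^ 5 + 2 * x ^ 2 * q ^ 6 -
      x ^ 3 * q ^ 9) * hJ 3 1 +
    (1 + x * q ^ 2 - x * q ^ 3 - x * q ^ 4 - x ^ 2 * q ^ 5 - x ^ 2 * q ^ 6 + x ^ 2 * q ^ 7 +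
      x ^ 3 * q ^ 9) * hJ 4 1 +
    (x ^ 2 * q ^ 5 + x ^ 2 * q ^ 6 + x ^ 2 * q ^ 7 + x ^ 3 * q ^ 8 + x ^ 3 * q ^ 9 +
      x ^ 3 * q ^ 10) * hJ 4 2 +
    (-x ^ 2 * q ^ 8 - x ^ 2 * q ^ 9 - x ^ 3 * q ^ 10 + x ^ 3 * q ^ 12 + x ^ 4 * q ^ 13 +
      x ^ 4 * q ^ 14) * hJ 5 2 +
    (-x ^ 2 * q ^ 9 - x ^ 3 * q ^ 11 + x ^ 3 * q ^ 13 + x ^ 3 * q ^ 14 + x ^ 4 * q ^ 15 +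
      x ^ 4 * q ^ 16 - x ^ 4 * q ^ 18 - x ^ 5 * q ^ 20) * hJ 7 3

/-- The `q³`-difference equation determines its solutions up to the constant term in `x`. -/
theorem CubicDilEq.eq {f g : Ser} (hf : CubicDilEq f) (hg : CubicDilEq g)
    (h0 : PowerSeries.coeff 0 f = PowerSeries.coeff 0 g) : f = g := by
  have key : ∀ n, ∀ m < n, PowerSeries.coeff m (f - g) = 0 := by
    intro n
    induction n with
    | zero => simp
    | succ n ih =>
      intro m hm
      rcases (Nat.lt_succ_iff.1 hm).lt_or_eq with hlt | rfl
      · exact ih m hlt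
      rcases m with _ | m
      · rw [map_sub, h0, sub_self]
      -- Modulo `x` the equation reads `f = dil 3 f`; the witnesses are the remaining coefficients
      -- divided by `x`.
      obtain ⟨r, s, t, hrst⟩ : ∃ r s t : Ser, f - g - dil 3 (f - g) =
          PowerSeries.X * (r * (f - g) + s * dil 3 (f - g) + t * dil 6 (f - g)) := by
        refine ⟨-q ^ 5, (1 + x * q ^ 5) * (1 - x * q ^ 2) * q ^ 3 + q ^ 2 + (1 + x * q ^ 2) *
          (q ^ 3 + 2 * q ^ 4 + 2 * q ^ 5 + x * (q ^ 8 + q ^ 9)),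
          q ^ 6 * (1 + x * q ^ 2) * (1 - x * q ^ 4) * (1 - x * q ^ 5), ?_⟩
        rw [← x]
        simp only [map_sub]
        unfold CubicDilEq at hf hg
        linear_combination hf - hg
      have hd : ∀ (k : ℕ) (r : Ser), PowerSeries.coeff m (r * dil k (f - g)) = 0 := by
        intro k r
        rw [PowerSeries.coeff_mul]
        refine Finset.sum_eq_zero fun p hp => ?_
        have := Finset.HasAntidiagonal.mem_antidiagonal.1 hp
        rw [coeff_dil, ih p.2 (by omega), mul_zero, mul_zero]
      have hd0 : dil 0 (f - g) = f - g := by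
        ext1 k
        simp [coeff_dil]
      have h := congrArg (PowerSeries.coeff (m + 1)) hrst
      rw [PowerSeries.coeff_succ_X_mul, map_add, map_add, hd, hd, ← hd0, hd, hd0, map_sub,
        coeff_dil, ← one_sub_mul, add_zero, add_zero] at h
      -- The factor `1 - q^(3(m+1))` is nonzero, having constant term 1 in `q`.
      refine (mul_eq_zero.1 h).resolve_left fun h1 => ?_
      have := congrArg (PowerSeries.coeff 0) h1
      simp at this
  rw [← sub_eq_zero]
  ext1 n
  rw [key (n + 1) n n.lt_succ_self, map_zero]

/-! ### Partitions: removing and adding a largest part -/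

theorem IntPartition.size_eq_sum_range (p : IntPartition) {n : ℕ} (h : ∀ j, n ≤ j → p.part j = 0) :
    p.size = ∑ j ∈ Finset.range n, p.part j := by
  refine Finset.sum_subset (fun j hj => ?_) fun j _ hj => Finsupp.notMem_support_iff.1 hj
  by_contra hlt
  exact Finsupp.mem_support_iff.1 hj (h j (by simpa using hlt))

theorem IntPartition.max_eq_part_zero (p : IntPartition) : p.max = p.part 0 := by
  refine le_antisymm (Finset.sup_le fun j _ => p.anti j.zero_le) ?_
  by_cases h : p.part 0 = 0
  · simp [h]
  · exact Finset.le_sup (f := p.part) (Finsupp.mem_support_iff.2 h)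

/-- The partition whose parts are the values of a given function. -/
noncomputable def IntPartition.ofFun (f : ℕ → ℕ) (hf : Antitone f) (n : ℕ)
    (h : ∀ j, n ≤ j → f j = 0) : IntPartition where
  part := Finsupp.ofSupportFinite f <| (Set.finite_Iio n).subset fun j hj => by
    by_contra hlt
    exact hj (h j (by simpa using hlt))
  anti := hf

/-- Remove the `e` largest parts. -/
noncomputable def IntPartition.drop (p : IntPartition) (e : ℕ) : IntPartition :=
  .ofFun (fun j => p.part (j + e)) (fun _ _ h => p.anti (by omega)) p.size
    fun _ h => p.part_eq_zero (by omega)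

@[simp]
theorem IntPartition.part_drop (p : IntPartition) (e j : ℕ) :
    (p.drop e).part j = p.part (j + e) := rfl

/-- Add a new largest part. -/
noncomputable def IntPartition.cons (m : ℕ) (p : IntPartition) (hm : p.part 0 ≤ m) :
    IntPartition :=
  .ofFun (fun j => j.casesOn m p.part)
    (antitone_nat_of_succ_le fun j => by
      cases j with
      | zero => exact hm
      | succ j => exact p.anti (Nat.le_succ j))
    (p.size + 1) fun j h => by
      cases j with
      | zero => omega
      | succ j => exact p.part_eq_zero (by omega)

@[simp]
theorem IntPartition.part_cons_zero (m : ℕ) (p : IntPartition) (hm : p.part 0 ≤ m) :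
    (p.cons m hm).part 0 = m := rfl

@[simp]
theorem IntPartition.part_cons_succ (m : ℕ) (p : IntPartition) (hm : p.part 0 ≤ m) (j : ℕ) :
    (p.cons m hm).part (j + 1) = p.part j := rfl

theorem IntPartition.size_cons (m : ℕ) (p : IntPartition) (hm : p.part 0 ≤ m) :
    (p.cons m hm).size = p.size + m := by
  rw [p.size_eq_sum_range (n := p.size) fun j h => p.part_eq_zero h,
    (p.cons m hm).size_eq_sum_range (n := p.size + 1), Finset.sum_range_succ']
  · simp
  · rintro (_ | j) h
    · omega
    · exact p.part_eq_zero (by omega)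

/-! ### Removing largest parts from cylindric partitions -/

/-- The profile after removal of the largest part from the components indexed by `J`. -/
def shrink {r : ℕ} (c : ZMod r → ℕ) (J : Finset (ZMod r)) (i : ZMod r) : ℕ :=
  c i + (if i - 1 ∈ J then 1 else 0) - if i ∈ J then 1 else 0

/-- Form of `shrink` free of truncated subtraction: it matches the index shifts in the cylindric
inequalities before and after deletion. -/
theorem shrink_add {r : ℕ} {c : ZMod r → ℕ} {J : Finset (ZMod r)} (hJ : ∀ i ∈ J, 0 < c i)
    (i : ZMod r) :
    shrink c J (i + 1) + (if i + 1 ∈ J then 1 else 0) = c (i + 1) + if i ∈ J then 1 else 0 := by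
  rw [shrink, add_sub_cancel_right]
  by_cases h : i + 1 ∈ J
  · have := hJ _ h
    simp only [h, if_true]
    split_ifs <;> omega
  · simp [h]

section

variable {r : ℕ} [NeZero r] {c : ZMod r → ℕ}

theorem CylPartition.part_le_max (l : CylPartition c) (i : ZMod r) (j : ℕ) :
    (l.comp i).part j ≤ l.max :=
  ((l.comp i).anti j.zero_le).trans <| (l.comp i).max_eq_part_zero.symm.trans_le <|
    Finset.le_sup (f := fun i => (l.comp i).max) (Finset.mem_univ i)

theorem CylPartition.max_le_iff (l : CylPartition c) (m : ℕ) :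
    l.max ≤ m ↔ ∀ i, (l.comp i).part 0 ≤ m := by
  simp [CylPartition.max, IntPartition.max_eq_part_zero]

/-- The indices of the components that contain the largest part. -/
def CylPartition.top (l : CylPartition c) : Finset (ZMod r) :=
  {i | (l.comp i).part 0 = l.max}

theorem CylPartition.mem_top (l : CylPartition c) (i : ZMod r) :
    i ∈ l.top ↔ (l.comp i).part 0 = l.max := by
  simp [CylPartition.top]

/-- If `c i = 0`, the inequality at `j = 1` passes the largest part from component `i` to component
`i - 1`. Were `c` zero on all of `l.top`, this would go all the way round the cylinder and force `c
= 0`. -/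
theorem CylPartition.exists_mem_top (l : CylPartition c) (hc : c ≠ 0) :
    ∃ i ∈ l.top, 0 < c i := by
  obtain ⟨i, -, hi⟩ := Finset.exists_mem_eq_sup Finset.univ Finset.univ_nonempty
    fun i : ZMod r => (l.comp i).max
  by_contra! h
  have key : ∀ n : ℕ, i - n ∈ l.top := by
    intro n
    induction n with
    | zero => simpa [l.mem_top, ← IntPartition.max_eq_part_zero, CylPartition.max] using hi.symm
    | succ n ih =>
      have h1 := l.cyl (i - (n + 1 : ℕ)) 0
      rw [show i - ((n + 1 : ℕ) : ZMod r) + 1 = i - n by push_cast; ring,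
        Nat.le_zero.1 (h _ ih), (l.mem_top _).1 ih] at h1
      exact (l.mem_top _).2 (le_antisymm (l.part_le_max _ _) h1)
  obtain ⟨j, hj⟩ := Function.ne_iff.1 hc
  have := key (i - j).val
  rw [ZMod.natCast_zmod_val, sub_sub_cancel] at this
  exact hj (Nat.le_zero.1 (h j this))

/-- Remove the first part of the components indexed by `J`. -/
noncomputable def CylPartition.shrink (l : CylPartition c) {J : Finset (ZMod r)}
    (hJ : ∀ i ∈ J, 0 < c i) : CylPartition (shrink c J) where
  comp i := (l.comp i).drop (if i ∈ J then 1 else 0)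
  cyl i j := by
    have := l.cyl i (j + if i ∈ J then 1 else 0)
    rw [add_assoc, add_comm (ite _ _ _), ← shrink_add hJ] at this
    simpa only [IntPartition.part_drop, add_assoc] using this

/-- Add a part to the components indexed by `J`, `k` larger than the largest part so far. -/
noncomputable def CylPartition.grow {J : Finset (ZMod r)} (hJ : ∀ i ∈ J, 0 < c i)
    (p : CylPartition (CylindricAG.shrink c J) × ℕ) : CylPartition c where
  comp i := if i ∈ J then
    (p.1.comp i).cons (p.1.max + p.2) ((p.1.part_le_max i 0).trans (Nat.le_add_right _ _))
    else p.1.comp i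
  cyl i j := by
    have h1 : ∀ i j, (if i ∈ J then (p.1.comp i).cons (p.1.max + p.2)
        ((p.1.part_le_max i 0).trans (Nat.le_add_right _ _)) else p.1.comp i).part
          (j + if i ∈ J then 1 else 0) = (p.1.comp i).part j := by
      intro i j
      split_ifs <;> simp
    have h2 : ∀ i j, (if i ∈ J then (p.1.comp i).cons (p.1.max + p.2)
        ((p.1.part_le_max i 0).trans (Nat.le_add_right _ _)) else p.1.comp i).part j
          ≤ p.1.max + p.2 := by
      intro i j
      split_ifs with h
      · cases j with
        | zero => simp
        | succ j => exact (p.1.part_le_max i j).trans (Nat.le_add_right _ _)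
      · exact (p.1.part_le_max i j).trans (Nat.le_add_right _ _)
    -- Only the inequality whose upper side is a newly added part is new, and it holds because that
    -- part is maximal. All others are inherited from `p.1` after an index shift.
    by_cases hij : i ∈ J ∧ j = 0
    · rw [if_pos hij.1 (α := IntPartition), hij.2, IntPartition.part_cons_zero]
      exact h2 _ _
    · obtain ⟨j, rfl⟩ : ∃ j', j = j' + if i ∈ J then 1 else 0 := by
        refine ⟨j - if i ∈ J then 1 else 0, ?_⟩
        split_ifs with h
        · have : j ≠ 0 := fun h0 => hij ⟨h, h0⟩
          omega
        · simp
      rw [add_assoc, add_comm (ite _ _ _), ← shrink_add hJ, ← add_assoc, h1, h1]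
      exact p.1.cyl i j

variable {J : Finset (ZMod r)} (hJ : ∀ i ∈ J, 0 < c i)
  (p : CylPartition (CylindricAG.shrink c J) × ℕ)

theorem CylPartition.grow_max (hne : J.Nonempty) : (grow hJ p).max = p.1.max + p.2 := by
  refine le_antisymm ((CylPartition.max_le_iff _ _).2 fun i => ?_) ?_
  · rw [CylPartition.grow]
    dsimp only
    split_ifs
    · simp
    · exact (p.1.part_le_max i 0).trans (Nat.le_add_right _ _)
  · obtain ⟨i, hi⟩ := hne
    refine le_trans (le_of_eq ?_) ((grow hJ p).part_le_max i 0)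
    rw [CylPartition.grow]
    dsimp only
    rw [if_pos hi, IntPartition.part_cons_zero]

theorem CylPartition.grow_size :
    (grow hJ p).size = p.1.size + J.card * (p.1.max + p.2) := by
  have h : ∀ i, ((grow hJ p).comp i).size =
      (p.1.comp i).size + if i ∈ J then p.1.max + p.2 else 0 := by
    intro i
    rw [CylPartition.grow]
    dsimp only
    split_ifs
    · rw [IntPartition.size_cons]
    · simp
  rw [CylPartition.size, Finset.sum_congr rfl fun i _ => h i, Finset.sum_add_distrib,
    Finset.sum_ite_mem, Finset.univ_inter, Finset.sum_const, smul_eq_mul, CylPartition.size]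

theorem CylPartition.subset_top_grow (hne : J.Nonempty) : J ⊆ (grow hJ p).top := by
  intro i hi
  rw [CylPartition.mem_top, grow_max _ _ hne, CylPartition.grow]
  dsimp only
  rw [if_pos hi, IntPartition.part_cons_zero]

theorem CylPartition.shrink_grow : (grow hJ p).shrink hJ = p.1 := by
  ext i j
  simp only [CylPartition.shrink, IntPartition.part_drop, CylPartition.grow]
  split_ifs <;> simp

theorem CylPartition.grow_injective (hne : J.Nonempty) : Function.Injective (grow hJ) := by
  intro p p' h
  have h1 : p.1 = p'.1 := by rw [← shrink_grow hJ p, h, shrink_grow]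
  have h2 := congrArg CylPartition.max h
  rw [grow_max _ _ hne, grow_max _ _ hne, h1] at h2
  exact Prod.ext h1 (by omega)

/-- With `subset_top_grow` and `grow_injective`, for nonempty `J` this makes `grow` a bijection onto
the partitions with `J ⊆ l.top`; the second coordinate records the drop of the maximum. -/
theorem CylPartition.mem_range_grow {l : CylPartition c} (hl : J ⊆ l.top) :
    l ∈ Set.range (grow hJ) := by
  have hle : (l.shrink hJ).max ≤ l.max :=
    (CylPartition.max_le_iff _ _).2 fun i => l.part_le_max _ _
  refine ⟨(l.shrink hJ, l.max - (l.shrink hJ).max), ?_⟩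
  ext i j
  simp only [CylPartition.grow, Nat.add_sub_cancel' hle]
  split_ifs with h
  · cases j with
    | zero => exact ((l.mem_top i).1 (hl h)).symm
    | succ j => simp [CylPartition.shrink, h]
  · simp [CylPartition.shrink, h]

/-! ### The functional equations -/

theorem summable_x_pow : Summable fun k : ℕ => x ^ k :=
  PowerSeries.WithPiTopology.summable_pow_of_constantCoeff_eq_zero (by simp [x])

theorem summable_max_add (c : ZMod r → ℕ) : Summable fun p : CylPartition c × ℕ =>
    x ^ p.1.max * q ^ p.1.size * x ^ p.2 := by
  refine summable_of_finite _ fun m n =>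
    (((finite_size_eq c n).prod (Set.finite_Iic m))).subset fun p hp => ?_
  rw [Set.mem_ofPred_eq, mul_right_comm, ← pow_add, coeff_x_pow_mul_q_pow] at hp
  have h : m = p.1.max + p.2 ∧ n = p.1.size := by
    by_contra h
    exact hp (if_neg h)
  exact ⟨h.2.symm, Set.mem_Iic.2 (by omega)⟩

theorem hasSum_max_add (c : ZMod r → ℕ) : HasSum (fun p : CylPartition c × ℕ =>
    x ^ p.1.max * q ^ p.1.size * x ^ p.2) (F c * ∑' k : ℕ, x ^ k) :=
  (summable_F c).hasSum.mul summable_x_pow.hasSum (summable_max_add c)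

/-- Under `grow`, a new maximum `m` contributes `x^m` and adds `J.card * m` to the size, which is
the effect of `dil J.card`. The free excess `k` gives the geometric series. -/
theorem tsum_subset_top (hJ : ∀ i ∈ J, 0 < c i) (hne : J.Nonempty) :
    (∑' l : CylPartition c, if J ⊆ l.top then x ^ l.max * q ^ l.size else 0) =
      dil J.card (F (shrink c J) * ∑' k : ℕ, x ^ k) := by
  rw [← (CylPartition.grow_injective hJ hne).tsum_eq, ← (hasSum_max_add _).tsum_eq,
    (summable_max_add _).map_tsum _ (continuous_dil _)]
  · refine tsum_congr fun p => ?_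
    rw [if_pos (CylPartition.subset_top_grow hJ p hne), CylPartition.grow_max _ _ hne,
      CylPartition.grow_size]
    simp only [map_mul, map_pow, dil_x, dil_q]
    ring
  · intro l hl
    refine CylPartition.mem_range_grow hJ ?_
    by_contra h
    exact hl (if_neg h)

/-- The indices of the nonzero entries of a profile. -/
def posIndices (c : ZMod r → ℕ) : Finset (ZMod r) := {i | 0 < c i}

/-- Inclusion-exclusion: the full alternating sum over subsets of `s ∩ t` vanishes, and the empty
set is moved to the other side. -/
theorem sum_sign_subset_eq_one {α : Type*} [DecidableEq α] {s t : Finset α}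
    (h : (s ∩ t).Nonempty) :
    ∑ J ∈ s.powerset.erase ∅, (if J ⊆ t then (-1 : Ser) ^ (J.card + 1) else 0) = 1 := by
  have h1 : ∑ J ∈ (s ∩ t).powerset, (-1 : Ser) ^ J.card = 0 := by
    have := congrArg (Int.cast : ℤ → Ser) (Finset.sum_powerset_neg_one_pow_card_of_nonempty h)
    push_cast at this
    exact this
  rw [← Finset.sum_filter]
  have h2 : (s.powerset.erase ∅).filter (· ⊆ t) = (s ∩ t).powerset.erase ∅ := by
    ext J
    simp only [Finset.mem_filter, Finset.mem_erase, Finset.mem_powerset, Finset.subset_inter_iff]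
    tauto
  rw [← Finset.add_sum_erase _ _ (Finset.empty_mem_powerset _)] at h1
  simp only [h2, pow_succ, mul_neg_one, Finset.sum_neg_distrib]
  rw [Finset.card_empty, pow_zero] at h1
  linear_combination -h1

/-- Each partition is counted with total sign 1, because its top set meets `posIndices c` by
`exists_mem_top`. Only subsets of `posIndices c` occur, as `shrink` requires. -/
theorem F_eq_sum (hc : c ≠ 0) :
    F c = ∑ J ∈ (posIndices c).powerset.erase ∅,
      (-1) ^ (J.card + 1) * dil J.card (F (shrink c J) * ∑' k : ℕ, x ^ k) := by
  have h1 : ∀ l : CylPartition c, x ^ l.max * q ^ l.size =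
      ∑ J ∈ (posIndices c).powerset.erase ∅,
        (-1) ^ (J.card + 1) * if J ⊆ l.top then x ^ l.max * q ^ l.size else 0 := by
    intro l
    obtain ⟨i, hi, hci⟩ := l.exists_mem_top hc
    have h := sum_sign_subset_eq_one (s := posIndices c) (t := l.top)
      ⟨i, Finset.mem_inter.2 ⟨by simp [posIndices, hci], hi⟩⟩
    refine (one_mul _).symm.trans ((congrArg (· * (x ^ l.max * q ^ l.size)) h.symm).trans ?_)
    simp only [Finset.sum_mul]
    refine Finset.sum_congr rfl fun J _ => ?_
    split_ifs <;> simp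
  have hs : ∀ J : Finset (ZMod r), Summable fun l : CylPartition c =>
      if J ⊆ l.top then x ^ l.max * q ^ l.size else 0 := by
    intro J
    refine summable_of_finite _ fun m n => (finite_size_eq c n).subset fun l hl => ?_
    rw [Set.mem_ofPred_eq] at hl
    split_ifs at hl
    · rw [coeff_x_pow_mul_q_pow] at hl
      by_contra h
      exact hl (if_neg fun h' => h h'.2.symm)
    · simp at hl
  rw [F, tsum_congr h1, Summable.tsum_finsetSum fun J _ => (hs J).mul_left _]
  refine Finset.sum_congr rfl fun J hJ => ?_
  rw [(hs J).tsum_mul_left, tsum_subset_top _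
    (Finset.nonempty_of_ne_empty (Finset.ne_of_mem_erase hJ))]
  intro i hi
  simpa [posIndices] using Finset.mem_powerset.1 (Finset.mem_of_mem_erase hJ) hi

theorem dil_pochInf (k : ℕ) :
    poch (x * q) q k * dil k (pochInf (x * q) q) = pochInf (x * q) q := by
  have h1 : ∀ k, dil k (pochInf (x * q) q) = ∏' j : ℕ, (1 - x * q * q ^ (j + k)) := by
    intro k
    rw [pochInf, multipliable_pochInf.map_tprod _ (continuous_dil k)]
    refine tprod_congr fun j => ?_
    simp only [map_sub, map_mul, map_pow, map_one, dil_x, dil_q]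
    ring
  have h2 : ∀ k, Multipliable fun j : ℕ => (1 - x * q * q ^ (j + k) : Ser) := by
    intro k
    refine (multipliable_pochInf.map (dil k) (continuous_dil k)).congr fun j => ?_
    simp only [Function.comp_apply, map_sub, map_mul, map_pow, map_one, dil_x, dil_q]
    ring
  induction k with
  | zero => rw [h1, poch, Finset.prod_range_zero, one_mul, pochInf]; simp only [add_zero]
  | succ k ih =>
    conv_rhs => rw [← ih, h1]
    rw [tprod_eq_zero_mul', h1, poch, poch, Finset.prod_range_succ, mul_assoc]
    · simp only [zero_add, add_assoc, add_comm 1 k]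
    · simpa only [add_assoc, add_comm 1 k] using h2 (k + 1)

/-- The Corteel–Welsh functional equations. -/
theorem G_eq_sum (hc : c ≠ 0) :
    G c = ∑ J ∈ (posIndices c).powerset.erase ∅,
      (-1) ^ (J.card + 1) * (poch (x * q) q (J.card - 1) * dil J.card (G (shrink c J))) := by
  rw [G, F_eq_sum hc, Finset.mul_sum]
  refine Finset.sum_congr rfl fun J hJ => ?_
  obtain ⟨k, hk⟩ : ∃ k, J.card = k + 1 := Nat.exists_eq_succ_of_ne_zero
    (Finset.card_ne_zero.2 (Finset.nonempty_of_ne_empty (Finset.ne_of_mem_erase hJ)))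
  have h1 : (1 - x) * ∑' k : ℕ, x ^ k = (1 : Ser) :=
    PowerSeries.WithPiTopology.one_sub_mul_tsum_pow_of_constantCoeff_eq_zero (by simp [x])
  have h2 := congrArg (dil (k + 1)) h1
  simp only [map_mul, map_sub, map_one, dil_x] at h2
  -- The dilated geometric series is `1/(1 - x q^(k+1))`; it cancels the last factor of `poch (x *
  -- q) q (k + 1)`, which explains the index `J.card - 1`.
  have h3 := dil_pochInf (k + 1)
  rw [poch, Finset.prod_range_succ, ← poch] at h3
  rw [hk, Nat.add_sub_cancel, G, map_mul, map_mul]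
  linear_combination (-1) ^ (k + 1 + 1) * dil (k + 1) (F (shrink c J)) *
    (poch (x * q) q k * dil (k + 1) (pochInf (x * q) q) * h2 -
      dil (k + 1) (∑' k : ℕ, x ^ k) * h3)

/-! ### Rotation invariance and the constant term -/

/-- Cyclic shift of a cylindric partition. -/
def CylPartition.rotate (s : ZMod r) : CylPartition c ≃ CylPartition fun i => c (i + s) where
  toFun l :=
    { comp := fun i => l.comp (i + s)
      cyl := fun i j => by simpa only [add_right_comm i s 1] using l.cyl (i + s) j }
  invFun l :=
    { comp := fun i => l.comp (i - s)
      cyl := fun i j => by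
        have h : (l.comp (i - s + 1)).part (j + c (i - s + 1 + s)) ≤ (l.comp (i - s)).part j :=
          l.cyl (i - s) j
        rwa [sub_add_eq_add_sub, sub_add_cancel] at h }
  left_inv l := by
    ext i j
    simp
  right_inv l := by
    ext i j
    simp

theorem G_rotate (c : ZMod r → ℕ) (s : ZMod r) : G (fun i => c (i + s)) = G c := by
  rw [G, G, F, F, ← (CylPartition.rotate s).tsum_eq]
  congr 1
  refine tsum_congr fun l => ?_
  congr 2
  · refine le_antisymm ((CylPartition.max_le_iff _ _).2 fun i => l.part_le_max _ _)
      ((CylPartition.max_le_iff _ _).2 fun i => ?_)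
    simpa [CylPartition.rotate] using (CylPartition.rotate s l).part_le_max (i - s) 0
  · exact Equiv.sum_comp (Equiv.addRight s) fun i => (l.comp i).size

theorem coeff_zero_G (c : ZMod r → ℕ) : PowerSeries.coeff 0 (G c) = 1 := by
  have hF : PowerSeries.coeff 0 (F c) = 1 := by
    have h := (PowerSeries.WithPiTopology.hasSum_iff_hasSum_coeff _).1 (summable_F c).hasSum 0
    let l₀ : CylPartition c := ⟨fun _ => ⟨0, fun _ _ _ => le_rfl⟩, fun _ _ => le_rfl⟩
    have h₀ : l₀.max = 0 := Nat.le_zero.1 ((CylPartition.max_le_iff _ _).2 fun _ => le_rfl)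
    have h₁ : l₀.size = 0 := by simp [CylPartition.size, IntPartition.size, l₀]
    refine h.unique ?_
    convert hasSum_single l₀ fun l hl => ?_ using 1
    · rw [h₀, h₁]
      simp
    · have : l.max ≠ 0 := by
        intro h0
        apply hl
        ext i j
        exact Nat.le_zero.1 (h0 ▸ l.part_le_max i j)
      simp [x, this]
  have hP : PowerSeries.coeff 0 (pochInf (x * q) q) = 1 := by
    rw [PowerSeries.coeff_zero_eq_constantCoeff_apply, pochInf,
      multipliable_pochInf.map_tprod _ (PowerSeries.WithPiTopology.continuous_constantCoeff _)]
    simp [x]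
  rw [PowerSeries.coeff_zero_eq_constantCoeff_apply] at *
  rw [G, map_mul, hP, hF, one_mul]

end

/-! ### Profiles of rank three and level three -/

/-- The ten profiles of rank and level three form four rotation orbits, represented by (3,0,0),
(2,1,0), (2,0,1) and (1,1,1), so this and the next three equations form a closed system. -/
theorem G_profile_three_zero_zero :
    G (profile ![3, 0, 0]) = dil 1 (G (profile ![2, 1, 0])) := by
  rw [G_eq_sum (by decide),
    show (posIndices (profile ![3, 0, 0])).powerset.erase ∅ = {{0}} by decide,
    Finset.sum_singleton,
    show shrink (profile ![3, 0, 0]) {0} = profile ![2, 1, 0] by decide]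
  simp [poch]

theorem G_profile_two_one_zero :
    G (profile ![2, 1, 0]) = 2 * dil 1 (G (profile ![2, 0, 1]))
      - (1 - x * q) * dil 2 (G (profile ![1, 1, 1])) := by
  rw [G_eq_sum (by decide),
    show (posIndices (profile ![2, 1, 0])).powerset.erase ∅ = {{0}, {1}, {0, 1}} by decide,
    Finset.sum_insert (by decide), Finset.sum_insert (by decide), Finset.sum_singleton,
    show shrink (profile ![2, 1, 0]) {0} = fun i => profile ![2, 0, 1] (i + 2) by decide,
    show shrink (profile ![2, 1, 0]) {1} = profile ![2, 0, 1] by decide,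
    show shrink (profile ![2, 1, 0]) {0, 1} = profile ![1, 1, 1] by decide,
    G_rotate, show ({0, 1} : Finset (ZMod 3)).card = 2 by decide]
  simp [poch]
  ring

theorem G_profile_two_zero_one :
    G (profile ![2, 0, 1]) = dil 1 (G (profile ![1, 1, 1])) + dil 1 (G (profile ![3, 0, 0]))
      - (1 - x * q) * dil 2 (G (profile ![2, 1, 0])) := by
  rw [G_eq_sum (by decide),
    show (posIndices (profile ![2, 0, 1])).powerset.erase ∅ = {{0}, {2}, {0, 2}} by decide,
    Finset.sum_insert (by decide), Finset.sum_insert (by decide), Finset.sum_singleton,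
    show shrink (profile ![2, 0, 1]) {0} = profile ![1, 1, 1] by decide,
    show shrink (profile ![2, 0, 1]) {2} = profile ![3, 0, 0] by decide,
    show shrink (profile ![2, 0, 1]) {0, 2} = profile ![2, 1, 0] by decide,
    show ({0, 2} : Finset (ZMod 3)).card = 2 by decide]
  simp [poch]
  ring

theorem G_profile_one_one_one :
    G (profile ![1, 1, 1]) = 3 * dil 1 (G (profile ![2, 1, 0]))
      - 3 * (1 - x * q) * dil 2 (G (profile ![2, 0, 1]))
      + (1 - x * q) * (1 - x * q ^ 2) * dil 3 (G (profile ![1, 1, 1])) := by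
  refine (G_eq_sum (by decide)).trans ?_
  rw [show (posIndices (profile ![1, 1, 1])).powerset.erase ∅ =
      {{0}, {1}, {2}, {0, 1}, {1, 2}, {0, 2}, {0, 1, 2}} by decide,
    Finset.sum_insert (by decide), Finset.sum_insert (by decide), Finset.sum_insert (by decide),
    Finset.sum_insert (by decide), Finset.sum_insert (by decide), Finset.sum_insert (by decide),
    Finset.sum_singleton,
    show shrink (profile ![1, 1, 1]) {0} = fun i => profile ![2, 1, 0] (i + 2) by decide,
    show shrink (profile ![1, 1, 1]) {1} = fun i => profile ![2, 1, 0] (i + 1) by decide,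
    show shrink (profile ![1, 1, 1]) {2} = profile ![2, 1, 0] by decide,
    show shrink (profile ![1, 1, 1]) {0, 1} = fun i => profile ![2, 0, 1] (i + 1) by decide,
    show shrink (profile ![1, 1, 1]) {1, 2} = profile ![2, 0, 1] by decide,
    show shrink (profile ![1, 1, 1]) {0, 2} = fun i => profile ![2, 0, 1] (i + 2) by decide,
    show shrink (profile ![1, 1, 1]) {0, 1, 2} = profile ![1, 1, 1] by decide,
    show ({0, 1} : Finset (ZMod 3)).card = 2 by decide,
    show ({1, 2} : Finset (ZMod 3)).card = 2 by decide,
    show ({0, 2} : Finset (ZMod 3)).card = 2 by decide,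
    show ({0, 1, 2} : Finset (ZMod 3)).card = 3 by decide]
  simp only [G_rotate]
  simp [poch, Finset.prod_range_succ]
  ring

theorem cubicDilEq_G : CubicDilEq (G (profile ![3, 0, 0])) := by
  have hH := G_profile_three_zero_zero
  have hB := G_profile_two_one_zero
  have hA := G_profile_two_zero_one
  have hC := G_profile_one_one_one
  set H := G (profile ![3, 0, 0])
  set B := G (profile ![2, 1, 0])
  set A := G (profile ![2, 0, 1])
  set C := G (profile ![1, 1, 1])
  have hdil : ∀ {f g : Ser} (k : ℕ), f = g → dil k f = dil k g := fun k h => congrArg _ h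
  have hH2 := hdil 2 hH
  have hA1 := hdil 1 hA
  simp only [map_sub, map_add, map_mul, map_one, dil_dil, dil_x, dil_q, Nat.reduceAdd] at hH2 hA1
  -- Elimination of `C`: since `H = dil 1 B`, the equation for `A` expresses `dil 2 C` through `A`
  -- and `H`.
  have hC2 : dil 2 C = dil 1 A - x * q ^ 2 * dil 2 H := by
    linear_combination -hA1 - (1 - x * q ^ 2) * hH2
  have hB' : B = (1 + x * q) * dil 1 A + (1 - x * q) * (x * q ^ 2) * dil 2 H := by
    linear_combination hB - (1 - x * q) * hC2
  have h1 := hdil 1 hB'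
  have h4 := hdil 4 hB'
  have hC3 := hdil 1 hC2
  have hC6 := hdil 4 hC2
  have hC3' := hdil 3 hC
  simp only [map_sub, map_add, map_mul, map_pow, map_one, map_ofNat, dil_dil, dil_x, dil_q,
    Nat.reduceAdd, ← hH] at h1 h4 hC3 hC6 hC3'
  have hH1 := hdil 3 hH
  rw [dil_dil] at hH1
  rw [← hH1] at h4
  -- The equation for `C`, dilated by `q³` and rewritten by `hC2`, relates only `A` and `H`.
  have hA2 : dil 2 A = (3 + x * q ^ 3) * dil 3 H - 3 * (1 - x * q ^ 4) * dil 5 A +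
      (1 - x * q ^ 4) * (1 - x * q ^ 5) * (dil 5 A - x * q ^ 6 * dil 6 H) := by
    linear_combination -hC3 + hC3' + (1 - x * q ^ 4) * (1 - x * q ^ 5) * hC6
  rw [CubicDilEq]
  -- `h1` and `h4` trade `dil 2 A` and `dil 5 A` for dilations of `H`. Clearing the coefficient `1 +
  -- x q⁵` of `dil 5 A` in `h4` is the source of that factor in `CubicDilEq`.
  linear_combination (1 + x * q ^ 5) * h1 + (1 + x * q ^ 2) * (1 + x * q ^ 5) * hA2 +
    (1 + x * q ^ 2) * (1 - x * q ^ 4) * (2 + x * q ^ 5) * h4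

theorem coeff_zero_pairSum (k l : ℕ) : PowerSeries.coeff 0 (pairSum k l) = 1 := by
  have h := (PowerSeries.WithPiTopology.hasSum_iff_hasSum_coeff _).1
    (summable_quadTerm k (k + 1) (3 * l) (3 * l)).hasSum 0
  refine h.unique ?_
  convert hasSum_single ((0, 0, 0, 0) : ℕ × ℕ × ℕ × ℕ) fun p hp => ?_ using 1
  · simp [quadTerm, invPoch, poch]
  · have : p.1 + p.2.1 + p.2.2.1 + 2 * p.2.2.2 ≠ 0 := by
      intro h0
      apply hp
      ext <;> simp <;> omega
    simp only [quadTerm, x]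
    rw [PowerSeries.coeff_mul_X_pow', if_neg (by omega)]

end CylindricAG

open CylindricAG in
theorem proposition7p3 :
    HasSum
      (fun (a, b, c, d) =>
        q ^ (a * (a + 1) + b * (b + 2) + 3 * c * (c + 1) + 3 * d * (d + 1)
            + 2 * a * b + 3 * a * c + 3 * a * d + 3 * b * c + 3 * b * d + 6 * c * d)
          * Ring.inverse
              (poch q q a * poch q q b * poch (q ^ 3) (q ^ 3) c * poch (q ^ 3) (q ^ 3) d)
          * x ^ (a + b + c + 2 * d) : ℕ × ℕ × ℕ × ℕ → Ser)
      (G (profile ![3, 0, 0])) := by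
  -- The exponent is the quadratic form of `quadTerm` plus `a + 2b + 3c + 3d`, hence `pairSum 1 1`.
  rw [cubicDilEq_G.eq cubicDilEq_pairSum (by rw [coeff_zero_G, coeff_zero_pairSum])]
  convert (summable_quadTerm 1 (1 + 1) (3 * 1) (3 * 1)).hasSum using 2 with p
  swap
  · rfl
  obtain ⟨a, b, c, d⟩ := p
  simp only [quadTerm, invPoch, pow_one, Ring.mul_inverse_rev]
  ring
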